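/- Conventions. $\mathbb{R}_+=[0,+\infty)$; $X$ is a real Banach space with dual $X^*$; $B_X(x,r)$ and $B_X[x,r]$ are the open and closed balls; $d(x,A)=\inf_{a\in A}\|x-a\|$ with $d(x,\emptyset)=+\infty$; $\mathrm{dom}(f)=\{x\in X: f(x)<+\infty\}$. An **admissible** function is a nondecreasing $\varphi:\mathbb{R}_+\to\mathbb{R}_+$ with $\varphi(0)=0$ and such that $\varphi(t_n)\to 0$ implies $t_n\to 0$ for all sequences $(t_n)$ in $\mathbb{R}_+$; $\varphi'_+$ is its right derivative. For a proper lower semicontinuous $f:X\to\mathbb{R}\cup\{+\infty\}$ and $u^*\in X^*$ let $f_{u^*}=f-u^*$. $f$ has **$\varphi$-SLWP** (stable local well-posedness with respect to $\varphi$) at $\bar x\in\mathrm{dom}(f)$ if there are $\delta,r,\tau,\kappa\in(0,+\infty)$ such that for every $u^*\in B_{X^*}(0,\delta)$ there is $x_{u^*}\in B_X[\bar x,r]$, with $x_0=\bar x$, satisfying $$\varphi(\kappa\|x-x_{u^*}\|)\le\tau\bigl(f_{u^*}(x)-f_{u^*}(x_{u^*})\bigr)\qquad\forall x\in B_X[\bar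 x,r].$$ $\partial f$ is the Clarke–Rockafellar subdifferential: for $x\in\mathrm{dom}(f)$, $\partial f(x)=\{x^*\in X^*:\langle x^*,h\rangle\le f^\uparrow(x,h)\ \forall h\in X\}$, where $$f^\uparrow(x,h)=\lim_{\varepsilon\downarrow0}\ \limsup_{u\to x,\ f(u)\to f(x),\ t\downarrow0}\ \inf_{\|w-h\|\le\varepsilon}\frac{f(u+tw)-f(u)}{t},$$ and $\partial f(x)=\emptyset$ for $x\notin\mathrm{dom}(f)$. Let $\psi$ be an admissible function, $F$ a multifunction from $X$ to a Banach space $Y$, and $\bar y\in F(\bar x)$; put $F^{-1}(y)=\{x: y\in F(x)\}$. $F$ is **strongly metrically $\psi$-regular** at $(\bar x,\bar y)$ if there are $r,\tau,\kappa,\delta\in(0,+\infty)$ such that $$\psi\bigl(\tau\, d(x,F^{-1}(y))\bigr)\le\kappa\, d(y,F(x))\qquad\forall (x,y)\in B_X(\bar x,r)\times B_Y(\bar y,r),$$ and $F^{-1}(y)\cap B_X(\bar x,\delta)$ is a singleton for all $y\in B_Y(\bar y,r)$. **Corollary 3.5.** Let $\varphi:\mathbb{R}_+\to\mathbb{R}_+$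 be a strictly convex differentiable admissible function with $\varphi'_+(0)=0$ (so that $\varphi'_+$ is itself admissible), let $f:X\to\mathbb{R}\cup\{+\infty\}$ be a proper lower semicontinuous convex function on the Banach space $X$, and let $\bar x\in\mathrm{dom}(f)$. Then $f$ has $\varphi$-SLWP at $\bar x$ if and only if $0\in\partial f(\bar x)$ and $\partial f$ is strongly metrically $\varphi'_+$-regular at $(\bar x,0)$. -/

import Mathlib

open Set Filter Topology

namespace StableWellPosedness

/-- Admissible functions `φ : ℝ₊ → ℝ₊`, represented by functions on `ℝ` of which only the values
on `[0, ∞)` matter: `φ` is nondecreasing on `[0, ∞)`, `φ 0 = 0` (so `φ ≥ 0` on `[0, ∞)`), and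
`φ (t) → 0` implies `t → 0`. -/
structure IsAdmissible (φ : ℝ → ℝ) : Prop where
  monotoneOn : MonotoneOn φ (Ici 0)
  map_zero : φ 0 = 0
  tendsto_zero : ∀ t : ℕ → ℝ, (∀ n, 0 ≤ t n) →
    Tendsto (fun n => φ (t n)) atTop (𝓝 0) → Tendsto t atTop (𝓝 0)

/-- The right derivative `φ'₊ (t)`, the limit of `(φ (t + s) - φ (t)) / s` as `s ↓ 0`. -/
noncomputable def rightDeriv (φ : ℝ → ℝ) (t : ℝ) : ℝ :=
  derivWithin φ (Ici t) t

/-- A proper function `f : X → ℝ ∪ {+∞}`: it never takes the value `-∞` and is not identically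
`+∞`. -/
structure IsProper {X : Type*} (f : X → EReal) : Prop where
  ne_bot : ∀ x, f x ≠ ⊥
  exists_ne_top : ∃ x, f x ≠ ⊤

/-- The effective domain of `f`. -/
def effDom {X : Type*} (f : X → EReal) : Set X :=
  {x | f x < ⊤}

/-- Convexity of a function `f : X → ℝ ∪ {+∞}`. -/
def IsConvexFun {X : Type*} [AddCommGroup X] [Module ℝ X] (f : X → EReal) : Prop :=
  ∀ (x y : X) (a b : ℝ), 0 < a → 0 < b → a + b = 1 →
    f (a • x + b • y) ≤ (a : EReal) * f x + (b : EReal) * f y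

section

variable {X : Type*} [NormedAddCommGroup X] [NormedSpace ℝ X]

/-- The tilted function `f_{u*} = f - u*`. -/
noncomputable def tilt (f : X → EReal) (u : StrongDual ℝ X) (x : X) : EReal :=
  f x - ((u x : ℝ) : EReal)

/-- `f` has stable local well-posedness at `xbar` with respect to `φ`. Here `M u` is the point
`x_{u*}`. If `f (M u) = +∞` then the inequality fails at `x = M u` because `⊤ - ⊤ = ⊥` in `EReal`,
so all points `M u` with `u` in the ball lie in the effective domain of `f`. -/
def HasSLWP (φ : ℝ → ℝ) (f : X → EReal) (xbar : X) : Prop :=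
  xbar ∈ effDom f ∧
  ∃ δ r τ κ : ℝ, 0 < δ ∧ 0 < r ∧ 0 < τ ∧ 0 < κ ∧
    ∃ M : StrongDual ℝ X → X, M 0 = xbar ∧
      ∀ u ∈ Metric.ball (0 : StrongDual ℝ X) δ,
        M u ∈ Metric.closedBall xbar r ∧
        ∀ x ∈ Metric.closedBall xbar r,
          ((φ (κ * ‖x - M u‖) : ℝ) : EReal) ≤ (τ : EReal) * (tilt f u x - tilt f u (M u))

/-- The generalized directional derivative `f↑(x, h)` of Rockafellar: the limit as `ε ↓ 0`
of the upper limit, as `u → x` with `f u → f x` and `t ↓ 0`, of the infimum over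
`w ∈ h + ε B` of `(f (u + t w) - f u) / t`. The upper limit is nonincreasing in `ε`, so the limit
as `ε ↓ 0` is the supremum over `ε > 0`. -/
noncomputable def upperSubderiv (f : X → EReal) (x h : X) : EReal :=
  ⨆ (ε : ℝ) (_ : 0 < ε),
    limsup
      (fun p : X × ℝ =>
        ⨅ w ∈ Metric.closedBall h ε, (f (p.1 + p.2 • w) - f p.1) / (p.2 : EReal))
      ((𝓝 x ⊓ comap f (𝓝 (f x))) ×ˢ 𝓝[>] (0 : ℝ))

/-- The Clarke-Rockafellar subdifferential of `f` at `x`; it is empty off the effective domain. -/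
def subdiff (f : X → EReal) (x : X) : Set (StrongDual ℝ X) :=
  {v | x ∈ effDom f ∧ ∀ h : X, ((v h : ℝ) : EReal) ≤ upperSubderiv f x h}

end

/-- The value `ψ (t)` for `t ∈ [0, ∞]`, with `ψ (∞) = ∞`. -/
noncomputable def extendTop (ψ : ℝ → ℝ) (t : ENNReal) : ENNReal :=
  open Classical in if t = ⊤ then ⊤ else ENNReal.ofReal (ψ t.toReal)

section

variable {X Y : Type*} [NormedAddCommGroup X] [NormedAddCommGroup Y]

/-- The inverse of a multifunction: `F⁻¹ (y) = {x | y ∈ F x}`. -/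
def multiInv (F : X → Set Y) (y : Y) : Set X :=
  {x | y ∈ F x}

/-- The inequality `ψ (τ d(x, F⁻¹ (y))) ≤ κ d(y, F (x))` for all `(x, y)` in the product of the
open balls of radius `r` around `xbar` and `ybar`, with the convention `d(z, ∅) = ∞`. -/
def RegularityInequality (ψ : ℝ → ℝ) (F : X → Set Y) (xbar : X) (ybar : Y) (r τ κ : ℝ) : Prop :=
  ∀ x ∈ Metric.ball xbar r, ∀ y ∈ Metric.ball ybar r,
    extendTop ψ (ENNReal.ofReal τ * Metric.infEDist x (multiInv F y)) ≤
      ENNReal.ofReal κ * Metric.infEDist y (F x)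

/-- `F` is strongly metrically `ψ`-regular at the point `(xbar, ybar)` of its graph. The second
condition makes every `F⁻¹ (y)` in the inequality nonempty, so the convention for `ψ (∞)` plays
no role. -/
def IsStronglyMetricallyRegular (ψ : ℝ → ℝ) (F : X → Set Y) (xbar : X) (ybar : Y) : Prop :=
  ybar ∈ F xbar ∧
  ∃ r τ κ δ : ℝ, 0 < r ∧ 0 < τ ∧ 0 < κ ∧ 0 < δ ∧
    RegularityInequality ψ F xbar ybar r τ κ ∧
    ∀ y ∈ Metric.ball ybar r, ∃ a : X, multiInv F y ∩ Metric.ball xbar δ = {a}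

end

end StableWellPosedness

/-! For convex `f`, `u ∈ ∂f(m)` says exactly that `m` minimizes `f_u` globally, so a map selecting
minimizers of small tilts is a local inverse of `∂f`. Growth and regularity are exchanged through
`φ'(a) a ≤ φ(2a)` and `φ(b) ≤ φ'(b) b`.

From growth to regularity: if `v ∈ ∂f(x)` and `m = M u`, then `f_u(x) - f_u(m) ≤ (v - u)(x - m) ≤ ‖u
- v‖ ‖x - m‖`. Growth bounds the left side below by a multiple of `φ(κ‖x - m‖)`, and dividing by `‖x
- m‖` leaves `φ'`.

From regularity to growth: put `q = ‖x - M u‖` and tilt further to `v = u + s g`, where `g` norms `x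
- M u`. If `κ s = φ'(τ q / 2)`, regularity and strict monotonicity of `φ'` keep `M v` within `q / 2`
of `M u`. Adding the subgradient inequalities at `M v` and `M u` gives `f_u(x) - f_u(M u) ≥ s g(x -
M v) ≥ s q / 2`, which dominates a multiple of `φ(τ q / 2)`. -/

namespace StableWellPosedness

/-! ### Convex admissible functions and their derivatives -/

section Admissible

variable {φ : ℝ → ℝ}

lemma IsAdmissible.nonneg (hφ : IsAdmissible φ) {t : ℝ} (ht : 0 ≤ t) : 0 ≤ φ t := by
  have := hφ.monotoneOn (mem_Ici.2 le_rfl) (mem_Ici.2 ht) ht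
  rwa [hφ.map_zero] at this

lemma IsAdmissible.pos (hφ : IsAdmissible φ) {t : ℝ} (ht : 0 < t) : 0 < φ t := by
  refine (hφ.nonneg ht.le).lt_of_ne fun h => ht.ne' ?_
  refine tendsto_nhds_unique tendsto_const_nhds
    (hφ.tendsto_zero (fun _ => t) (fun _ => ht.le) ?_)
  simp [← h]

lemma rightDeriv_eq_derivWithin_Ici (hd : DifferentiableOn ℝ φ (Ici 0)) {t : ℝ} (ht : 0 ≤ t) :
    rightDeriv φ t = derivWithin φ (Ici 0) t :=
  ((hd t ht).hasDerivWithinAt.mono (Ici_subset_Ici.2 ht)).derivWithin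
    (uniqueDiffWithinAt_Ici t)

lemma strictMonoOn_rightDeriv (hc : StrictConvexOn ℝ (Ici 0) φ)
    (hd : DifferentiableOn ℝ φ (Ici 0)) : StrictMonoOn (rightDeriv φ) (Ici 0) := by
  intro a ha b hb hab
  rw [rightDeriv_eq_derivWithin_Ici hd ha, rightDeriv_eq_derivWithin_Ici hd hb]
  exact hc.strictMonoOn_derivWithin hd ha hb hab

lemma rightDeriv_mul_sub_le (hc : ConvexOn ℝ (Ici 0) φ) (hd : DifferentiableOn ℝ φ (Ici 0))
    {a b : ℝ} (ha : 0 ≤ a) (hab : a < b) : rightDeriv φ a * (b - a) ≤ φ b - φ a := by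
  have h := hc.derivWithin_le_slope (mem_Ici.2 ha) (mem_Ici.2 (ha.trans hab.le)) hab (hd a ha)
  rwa [← rightDeriv_eq_derivWithin_Ici hd ha, slope_def_field, le_div_iff₀ (sub_pos.2 hab)] at h

lemma sub_le_rightDeriv_mul (hc : ConvexOn ℝ (Ici 0) φ) (hd : DifferentiableOn ℝ φ (Ici 0))
    {a b : ℝ} (ha : 0 ≤ a) (hab : a < b) : φ b - φ a ≤ rightDeriv φ b * (b - a) := by
  have hb := ha.trans hab.le
  have h := hc.slope_le_derivWithin (mem_Ici.2 ha) (mem_Ici.2 hb) hab (hd b hb)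
  rwa [← rightDeriv_eq_derivWithin_Ici hd hb, slope_def_field, div_le_iff₀ (sub_pos.2 hab)] at h

/-- The tangent at `a`, evaluated at `2a`, lies below `φ`, and `φ a ≥ 0` can be dropped. -/
lemma IsAdmissible.rightDeriv_mul_le (hφ : IsAdmissible φ) (hc : ConvexOn ℝ (Ici 0) φ)
    (hd : DifferentiableOn ℝ φ (Ici 0)) {a : ℝ} (ha : 0 ≤ a) :
    rightDeriv φ a * a ≤ φ (2 * a) := by
  rcases ha.eq_or_lt with rfl | ha'
  · simp [hφ.map_zero]
  · have h := rightDeriv_mul_sub_le hc hd ha (show a < 2 * a by linarith)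
    have := hφ.nonneg ha
    linarith [show rightDeriv φ a * (2 * a - a) = rightDeriv φ a * a by ring]

lemma IsAdmissible.le_rightDeriv_mul (hφ : IsAdmissible φ) (hc : ConvexOn ℝ (Ici 0) φ)
    (hd : DifferentiableOn ℝ φ (Ici 0)) {b : ℝ} (hb : 0 ≤ b) : φ b ≤ rightDeriv φ b * b := by
  rcases hb.eq_or_lt with rfl | hb'
  · simp [hφ.map_zero]
  · simpa [hφ.map_zero] using sub_le_rightDeriv_mul hc hd le_rfl hb'

/-- The slope `φ(t)/t` tends to `0`, and `φ'(t/2) · (t/2) ≤ φ(t)` transfers this to the derivative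
at the cost of a factor `2`. -/
lemma IsAdmissible.exists_rightDeriv_lt (hφ : IsAdmissible φ) (hc : ConvexOn ℝ (Ici 0) φ)
    (hd : DifferentiableOn ℝ φ (Ici 0)) (h0 : rightDeriv φ 0 = 0) {η : ℝ} (hη : 0 < η) :
    ∃ T, 0 < T ∧ rightDeriv φ T < η := by
  have h : HasDerivWithinAt φ 0 (Ioi 0) 0 := by
    have h' := (hd 0 (mem_Ici.2 le_rfl)).hasDerivWithinAt
    rw [← rightDeriv_eq_derivWithin_Ici hd le_rfl, h0] at h'
    exact h'.mono Ioi_subset_Ici_self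
  rw [hasDerivWithinAt_iff_tendsto_slope' self_notMem_Ioi] at h
  have h2 : ∀ᶠ t in 𝓝[>] (0 : ℝ), slope φ 0 t < η / 2 := h.eventually_lt_const (half_pos hη)
  obtain ⟨t, ht, ht0⟩ := (h2.and self_mem_nhdsWithin).exists
  have ht0 : 0 < t := ht0
  refine ⟨t / 2, half_pos ht0, ?_⟩
  rw [slope_def_field, hφ.map_zero, sub_zero, sub_zero, div_lt_iff₀ ht0] at ht
  have h3 := hφ.rightDeriv_mul_le hc hd (half_pos ht0).le
  rw [mul_div_cancel₀ _ two_ne_zero] at h3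
  by_contra! hcon
  nlinarith

end Admissible

lemma IsProper.coe_toReal {X : Type*} {f : X → EReal} (hf : IsProper f) {x : X} (hx : x ∈ effDom f) :
    ((f x).toReal : EReal) = f x :=
  EReal.coe_toReal (ne_of_lt hx) (hf.ne_bot x)

/-! ### Subgradients of convex functions -/

section Subgradient

variable {X : Type*} [NormedAddCommGroup X] [NormedSpace ℝ X] {f : X → EReal}

/-- `u` is a subgradient of `f` at `x` in the sense of convex analysis. -/
def IsSubgradient (f : X → EReal) (x : X) (u : StrongDual ℝ X) : Prop :=
  x ∈ effDom f ∧ ∀ y ∈ effDom f, (f x).toReal + u (y - x) ≤ (f y).toReal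

lemma IsProper.convexComb (hf : IsProper f) (hc : IsConvexFun f) {x y : X}
    (hx : x ∈ effDom f) (hy : y ∈ effDom f) {t : ℝ} (h0 : 0 < t) (h1 : t < 1) :
    (1 - t) • x + t • y ∈ effDom f ∧
      (f ((1 - t) • x + t • y)).toReal ≤ (1 - t) * (f x).toReal + t * (f y).toReal := by
  have h := hc x y (1 - t) t (sub_pos.2 h1) h0 (by ring)
  rw [← hf.coe_toReal hx, ← hf.coe_toReal hy, ← EReal.coe_mul, ← EReal.coe_mul,
    ← EReal.coe_add] at h
  have hz : (1 - t) • x + t • y ∈ effDom f := h.trans_lt (EReal.coe_lt_top _)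
  refine ⟨hz, ?_⟩
  rwa [← hf.coe_toReal hz, EReal.coe_le_coe_iff] at h

lemma exists_convexComb_mem {U : Set X} (hU : IsOpen U) {m : X} (hm : m ∈ U) (y : X) :
    ∃ t : ℝ, 0 < t ∧ t < 1 ∧ (1 - t) • m + t • y ∈ U := by
  have hcont : Continuous fun t : ℝ => (1 - t) • m + t • y := by fun_prop
  have h1 : ∀ᶠ t : ℝ in 𝓝[>] 0, (1 - t) • m + t • y ∈ U :=
    (hcont.tendsto' 0 m (by simp)).mono_left nhdsWithin_le_nhds |>.eventually (hU.mem_nhds hm)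
  have h2 : ∀ᶠ t : ℝ in 𝓝[>] 0, t ∈ Ioo (0 : ℝ) 1 := Ioo_mem_nhdsGT one_pos
  obtain ⟨t, ht, ht0, ht1⟩ := (h1.and h2).exists
  exact ⟨t, ht0, ht1, ht⟩

/-- A limsup is bounded below along any path tending to the base filter. On the path `(x, t)` with
fixed base point every quotient is at least `u w ≥ u d - ‖u‖ ε`; then `ε ↓ 0`. -/
lemma IsSubgradient.le_upperSubderiv (hf : IsProper f) {x : X} {u : StrongDual ℝ X}
    (h : IsSubgradient f x u) (d : X) : ((u d : ℝ) : EReal) ≤ upperSubderiv f x d := by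
  obtain ⟨hx, hu⟩ := h
  have key : ∀ ε : ℝ, 0 < ε → ((u d - ‖u‖ * ε : ℝ) : EReal) ≤ upperSubderiv f x d := by
    intro ε hε
    refine le_trans ?_ (le_iSup₂ (f := fun (ε : ℝ) (_ : 0 < ε) => limsup
      (fun p : X × ℝ =>
        ⨅ w ∈ Metric.closedBall d ε, (f (p.1 + p.2 • w) - f p.1) / (p.2 : EReal))
      ((𝓝 x ⊓ comap f (𝓝 (f x))) ×ˢ 𝓝[>] (0 : ℝ))) ε hε)
    apply le_limsup_of_frequently_le'
    have ht : Tendsto (fun t : ℝ => (x, t)) (𝓝[>] 0)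
        ((𝓝 x ⊓ comap f (𝓝 (f x))) ×ˢ 𝓝[>] (0 : ℝ)) := by
      refine Tendsto.prodMk ?_ tendsto_id
      rw [tendsto_inf, tendsto_comap_iff]
      exact ⟨tendsto_const_nhds, tendsto_const_nhds⟩
    refine ht.frequently (Eventually.frequently ?_)
    filter_upwards [self_mem_nhdsWithin] with t ht0
    have ht0 : 0 < t := ht0
    refine le_iInf₂ fun w hw => ?_
    have hw : ‖w - d‖ ≤ ε := by simpa [dist_eq_norm] using hw
    by_cases hz : x + t • w ∈ effDom f
    · rw [← hf.coe_toReal hz, ← hf.coe_toReal hx, ← EReal.coe_sub, ← EReal.coe_div,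
        EReal.coe_le_coe_iff, le_div_iff₀ ht0]
      have h1 := hu _ hz
      rw [add_sub_cancel_left, map_smul, smul_eq_mul] at h1
      have h2 : u d - ‖u‖ * ε ≤ u w := by
        have h3 := (abs_le.1 ((Real.norm_eq_abs _).symm.trans_le (u.le_opNorm (w - d)))).1
        rw [map_sub] at h3
        nlinarith [norm_nonneg u]
      nlinarith
    · have hz : f (x + t • w) = ⊤ := not_lt_top_iff.1 hz
      rw [hz, ← hf.coe_toReal hx, EReal.top_sub_coe,
        EReal.top_div_of_pos_ne_top (by exact_mod_cast ht0) (EReal.coe_ne_top t)]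
      exact le_top
  have hlim : Tendsto (fun ε : ℝ => ((u d - ‖u‖ * ε : ℝ) : EReal)) (𝓝[>] 0) (𝓝 (u d : ℝ)) := by
    refine (continuous_coe_real_ereal.tendsto _).comp ?_
    have : Continuous fun ε : ℝ => u d - ‖u‖ * ε := by fun_prop
    exact (this.tendsto' 0 (u d) (by simp)).mono_left nhdsWithin_le_nhds
  refine le_of_tendsto hlim ?_
  filter_upwards [self_mem_nhdsWithin] with ε hε using key ε hε

/-- For a base point `z` within `ε` of `x`, the direction `y - z` competes in the infimum. Convexity
along the segment from `z` to `y` bounds its quotient by `f y - f z`, and `f z → f x` along the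
filter. -/
lemma upperSubderiv_sub_le (hf : IsProper f) (hc : IsConvexFun f) {x y : X}
    (hx : x ∈ effDom f) (hy : y ∈ effDom f) :
    upperSubderiv f x (y - x) ≤ (((f y).toReal - (f x).toReal : ℝ) : EReal) := by
  refine iSup₂_le fun ε hε => ?_
  refine EReal.le_of_forall_lt_iff_le.1 fun c hc' => ?_
  rw [EReal.coe_lt_coe_iff] at hc'
  refine limsup_le_of_le (h := ?_)
  have e1 : ∀ᶠ z in 𝓝 x ⊓ comap f (𝓝 (f x)), dist z x ≤ ε :=
    Eventually.filter_mono inf_le_left (Metric.closedBall_mem_nhds x hε)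
  have e2 : ∀ᶠ z in 𝓝 x ⊓ comap f (𝓝 (f x)), f z < ⊤ :=
    Eventually.filter_mono inf_le_right ((eventually_lt_nhds hx).comap f)
  have e3 : ∀ᶠ z in 𝓝 x ⊓ comap f (𝓝 (f x)), (((f y).toReal - c : ℝ) : EReal) < f z := by
    refine Eventually.filter_mono inf_le_right ((eventually_gt_nhds ?_).comap f)
    rw [← hf.coe_toReal hx, EReal.coe_lt_coe_iff]
    linarith
  have e4 : ∀ᶠ t : ℝ in 𝓝[>] 0, t ∈ Ioo (0 : ℝ) 1 := Ioo_mem_nhdsGT one_pos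
  filter_upwards [((e1.and e2).and e3).prod_mk e4]
  rintro ⟨z, t⟩ ⟨⟨⟨hzx, hz⟩, hzc⟩, ht0, ht1⟩
  dsimp only at *
  refine (iInf₂_le (y - z) ?_).trans ?_
  · rw [Metric.mem_closedBall, dist_eq_norm, sub_sub_sub_cancel_left, ← dist_eq_norm, dist_comm]
    exact hzx
  · obtain ⟨hd, hle⟩ := hf.convexComb hc hz hy ht0 ht1
    have hzt : z + t • (y - z) = (1 - t) • z + t • y := by module
    rw [← hf.coe_toReal (x := z) hz, EReal.coe_lt_coe_iff] at hzc
    rw [hzt, ← hf.coe_toReal hd, ← hf.coe_toReal (x := z) hz, ← EReal.coe_sub, ← EReal.coe_div,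
      EReal.coe_le_coe_iff, div_le_iff₀ ht0]
    nlinarith

/-- For convex functions the Clarke-Rockafellar subdifferential is the convex one. -/
lemma mem_subdiff_iff (hf : IsProper f) (hc : IsConvexFun f) {x : X} {u : StrongDual ℝ X} :
    u ∈ subdiff f x ↔ IsSubgradient f x u := by
  refine ⟨fun ⟨hx, hu⟩ => ⟨hx, fun y hy => ?_⟩, fun h => ⟨h.1, h.le_upperSubderiv hf⟩⟩
  have h := (hu (y - x)).trans (upperSubderiv_sub_le hf hc hx hy)
  rw [EReal.coe_le_coe_iff] at h
  linarith

lemma IsSubgradient.convexComb (hf : IsProper f) (hc : IsConvexFun f) {x y : X}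
    {u : StrongDual ℝ X} (hx : IsSubgradient f x u) (hy : IsSubgradient f y u) {t : ℝ}
    (h0 : 0 < t) (h1 : t < 1) : IsSubgradient f ((1 - t) • x + t • y) u := by
  obtain ⟨hd, hle⟩ := hf.convexComb hc hx.1 hy.1 h0 h1
  refine ⟨hd, fun z hz => ?_⟩
  have hx' := hx.2 z hz
  have hy' := hy.2 z hz
  simp only [map_sub, map_add, map_smul, smul_eq_mul] at *
  nlinarith

/-- The set of points with subgradient `u` is convex: a second such point anywhere would produce one
in `U` on the segment near `a`. -/
lemma multiInv_subdiff_eq_singleton (hf : IsProper f) (hc : IsConvexFun f)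
    {u : StrongDual ℝ X} {U : Set X} (hU : IsOpen U) {a : X}
    (h : multiInv (subdiff f) u ∩ U = {a}) : multiInv (subdiff f) u = {a} := by
  have ha : a ∈ multiInv (subdiff f) u ∩ U := h ▸ mem_singleton a
  refine Subset.antisymm (fun b hb => ?_) (singleton_subset_iff.2 ha.1)
  obtain ⟨t, ht0, ht1, htU⟩ := exists_convexComb_mem hU ha.2 b
  have hm : (1 - t) • a + t • b ∈ multiInv (subdiff f) u ∩ U :=
    ⟨(mem_subdiff_iff hf hc).2 (((mem_subdiff_iff hf hc).1 ha.1).convexComb hf hc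
      ((mem_subdiff_iff hf hc).1 hb) ht0 ht1), htU⟩
  rw [h, mem_singleton_iff] at hm
  have h2 : t • (b - a) = 0 := by
    rw [← sub_eq_zero.2 hm]
    module
  exact sub_eq_zero.1 ((smul_eq_zero.1 h2).resolve_left ht0.ne')

/-- Local minimizers of a tilted convex function are characterized by subgradients. -/
lemma IsSubgradient.of_local (hf : IsProper f) (hc : IsConvexFun f) {m : X}
    {u : StrongDual ℝ X} {U : Set X} (hU : IsOpen U) (hmU : m ∈ U) (hm : m ∈ effDom f)
    (h : ∀ x ∈ U, x ∈ effDom f → (f m).toReal - u m ≤ (f x).toReal - u x) :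
    IsSubgradient f m u := by
  refine ⟨hm, fun y hy => ?_⟩
  obtain ⟨t, ht0, ht1, htU⟩ := exists_convexComb_mem hU hmU y
  obtain ⟨hd, hle⟩ := hf.convexComb hc hm hy ht0 ht1
  have h1 := h _ htU hd
  simp only [map_sub, map_add, map_smul, smul_eq_mul] at *
  have h2 : t * ((f m).toReal + (u y - u m)) ≤ t * (f y).toReal := by linarith
  exact le_of_mul_le_mul_left h2 ht0

lemma coe_le_mul_tilt_sub_iff (hf : IsProper f) {u : StrongDual ℝ X} {m x : X}
    (hm : m ∈ effDom f) {τ c : ℝ} (hτ : 0 < τ) :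
    (c : EReal) ≤ (τ : EReal) * (tilt f u x - tilt f u m) ↔
      (x ∈ effDom f → c ≤ τ * (((f x).toReal - u x) - ((f m).toReal - u m))) := by
  unfold tilt
  rw [← hf.coe_toReal hm]
  by_cases hx : x ∈ effDom f
  · rw [← hf.coe_toReal hx]
    simp only [EReal.toReal_coe]
    norm_cast
    simp [hx]
  · have hx' : f x = ⊤ := not_lt_top_iff.1 hx
    rw [hx', EReal.top_sub_coe, ← EReal.coe_sub, EReal.top_sub_coe,
      EReal.coe_mul_top_of_pos hτ]
    simp [hx]

lemma mem_effDom_of_coe_le_mul_tilt_sub {u : StrongDual ℝ X} {m : X} {τ c : ℝ}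
    (hτ : 0 < τ) (h : (c : EReal) ≤ (τ : EReal) * (tilt f u m - tilt f u m)) :
    m ∈ effDom f := by
  by_contra hm
  have hm' : f m = ⊤ := not_lt_top_iff.1 hm
  unfold tilt at h
  rw [hm', EReal.top_sub_coe, EReal.sub_top, EReal.coe_mul_bot_of_pos hτ] at h
  exact EReal.coe_ne_bot c (le_bot_iff.1 h)

end Subgradient

/-! ### Metric regularity in real-valued form -/

lemma regularityInequality_iff {X Y : Type*} [NormedAddCommGroup X] [NormedAddCommGroup Y]
    {ψ : ℝ → ℝ} {F : X → Set Y} {xbar : X} {ybar : Y} {r τ κ : ℝ} (hτ : 0 ≤ τ) (hκ : 0 < κ)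
    {M : Y → X} (hM : ∀ y ∈ Metric.ball ybar r, multiInv F y = {M y}) :
    RegularityInequality ψ F xbar ybar r τ κ ↔
      ∀ x ∈ Metric.ball xbar r, ∀ y ∈ Metric.ball ybar r, ∀ z ∈ F x,
        ψ (τ * ‖x - M y‖) ≤ κ * ‖y - z‖ := by
  refine forall₂_congr fun x _ => forall₂_congr fun y hy => ?_
  have h1 : ENNReal.ofReal τ * edist x (M y) = ENNReal.ofReal (τ * ‖x - M y‖) := by
    rw [ENNReal.ofReal_mul hτ, edist_dist, dist_eq_norm]
  rw [hM y hy, Metric.infEDist_singleton, h1, extendTop, if_neg ENNReal.ofReal_ne_top,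
    ENNReal.toReal_ofReal (by positivity), mul_comm (ENNReal.ofReal κ),
    -- Dividing by `κ` isolates the distance to `F x`, so that the bound can be tested on each `z ∈
    -- F x`; an empty `F x` imposes nothing on either side.
    ← ENNReal.div_le_iff (ENNReal.ofReal_pos.2 hκ).ne' ENNReal.ofReal_ne_top,
    Metric.le_infEDist]
  refine forall₂_congr fun z _ => ?_
  rw [ENNReal.div_le_iff (ENNReal.ofReal_pos.2 hκ).ne' ENNReal.ofReal_ne_top, edist_dist,
    dist_eq_norm, ← ENNReal.ofReal_mul (norm_nonneg _), ENNReal.ofReal_le_ofReal_iff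
    (by positivity), mul_comm κ]

/-! ### The two implications -/

section Equivalence

variable {X : Type*} [NormedAddCommGroup X] [NormedSpace ℝ X] {f : X → EReal} {φ : ℝ → ℝ}
  {xbar : X}

theorem HasSLWP.isStronglyMetricallyRegular (hφ : IsAdmissible φ) (hφc : ConvexOn ℝ (Ici 0) φ)
    (hφd : DifferentiableOn ℝ φ (Ici 0)) (hφ0 : rightDeriv φ 0 = 0) (hf : IsProper f)
    (hc : IsConvexFun f)
    (h : HasSLWP φ f xbar) :
    IsStronglyMetricallyRegular (rightDeriv φ) (subdiff f) xbar 0 := by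
  obtain ⟨hxbar, δ, r, τ, κ, hδ, hr, hτ, hκ, M, hM0, hM⟩ := h
  have hdom : ∀ u ∈ Metric.ball (0 : StrongDual ℝ X) δ, M u ∈ effDom f := fun u hu =>
    mem_effDom_of_coe_le_mul_tilt_sub hτ ((hM u hu).2 (M u) (hM u hu).1)
  have hgrow : ∀ u ∈ Metric.ball (0 : StrongDual ℝ X) δ, ∀ x ∈ Metric.closedBall xbar r,
      x ∈ effDom f →
      φ (κ * ‖x - M u‖) ≤ τ * (((f x).toReal - u x) - ((f (M u)).toReal - u (M u))) :=
    fun u hu x hx => (coe_le_mul_tilt_sub_iff hf (hdom u hu) hτ).1 ((hM u hu).2 x hx)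
  have hmin : ∀ u ∈ Metric.ball (0 : StrongDual ℝ X) δ, ∀ x ∈ Metric.closedBall xbar r,
      x ∈ effDom f → (f (M u)).toReal - u (M u) ≤ (f x).toReal - u x := by
    intro u hu x hx hxd
    have h1 := (hφ.nonneg (by positivity : 0 ≤ κ * ‖x - M u‖)).trans (hgrow u hu x hx hxd)
    linarith [nonneg_of_mul_nonneg_right h1 hτ]
  -- The last term keeps `M u` off the boundary sphere: growth for the zero tilt and minimality of
  -- `M u` give `φ(κ‖M u - xbar‖) ≤ τ‖u‖r < φ(κ r)`. Interior minimizers are global ones.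
  set ρ := min (min δ r) (φ (κ * r) / (τ * r)) with hρ
  have hρpos : 0 < ρ := lt_min (lt_min hδ hr) (div_pos (hφ.pos (by positivity)) (by positivity))
  have hρδ : ∀ u ∈ Metric.ball (0 : StrongDual ℝ X) ρ, u ∈ Metric.ball (0 : StrongDual ℝ X) δ :=
    Metric.ball_subset_ball ((min_le_left _ _).trans (min_le_left _ _))
  have hρr : Metric.ball xbar ρ ⊆ Metric.ball xbar r :=
    Metric.ball_subset_ball ((min_le_left _ _).trans (min_le_right _ _))
  have hball : ∀ u ∈ Metric.ball (0 : StrongDual ℝ X) ρ, M u ∈ Metric.ball xbar r := by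
    intro u hu
    have hu' := hρδ u hu
    have h0 := hgrow 0 (Metric.mem_ball_self hδ) (M u) (hM u hu').1 (hdom u hu')
    have h1 := hmin u hu' xbar (Metric.mem_closedBall_self hr.le) hxbar
    simp only [hM0, zero_apply, sub_zero] at h0
    have h2 : ‖M u - xbar‖ ≤ r := by simpa [dist_eq_norm] using (hM u hu').1
    have h3 : u (M u) - u xbar ≤ ‖u‖ * r := by
      rw [← map_sub]
      exact (le_abs_self _).trans ((u.le_opNorm _).trans (by gcongr))
    have hu2 : ‖u‖ < φ (κ * r) / (τ * r) :=
      (mem_ball_zero_iff.1 hu).trans_le (min_le_right _ _)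
    rw [lt_div_iff₀ (by positivity)] at hu2
    rw [mem_ball_iff_norm]
    by_contra! hcon
    have h4 := hφ.monotoneOn (mem_Ici.2 (by positivity)) (mem_Ici.2 (by positivity))
      (mul_le_mul_of_nonneg_left hcon hκ.le)
    nlinarith
  have hsub : ∀ u ∈ Metric.ball (0 : StrongDual ℝ X) ρ, IsSubgradient f (M u) u := fun u hu =>
    .of_local hf hc Metric.isOpen_ball (hball u hu) (hdom u (hρδ u hu)) fun x hx =>
      hmin u (hρδ u hu) x (Metric.ball_subset_closedBall hx)
  have hsing : ∀ u ∈ Metric.ball (0 : StrongDual ℝ X) ρ,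
      multiInv (subdiff f) u ∩ Metric.ball xbar r = {M u} := by
    refine fun u hu => Subset.antisymm (fun a ha => ?_)
      (singleton_subset_iff.2 ⟨(mem_subdiff_iff hf hc).2 (hsub u hu), hball u hu⟩)
    obtain ⟨had, hale⟩ := (mem_subdiff_iff hf hc).1 ha.1
    have h1 := hgrow u (hρδ u hu) a (Metric.ball_subset_closedBall ha.2) had
    have h2 := hale (M u) (hsub u hu).1
    rw [map_sub] at h2
    have h3 : φ (κ * ‖a - M u‖) ≤ 0 := h1.trans (mul_nonpos_of_nonneg_of_nonpos hτ.le (by linarith))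
    by_contra hne
    exact h3.not_gt (hφ.pos (mul_pos hκ (norm_sub_pos_iff.2 hne)))
  -- With `a = (κ/2)‖x - M u‖`, the bound `φ'(a) a ≤ φ(2a)` matches the growth term; cancelling
  -- `(κ/2)‖x - M u‖` leaves the factor `2τ/κ`.
  refine ⟨?_, ρ, κ / 2, 2 * τ / κ, r, hρpos, by positivity, by positivity, hr, ?_,
    fun u hu => ⟨M u, hsing u hu⟩⟩
  · have := hsub 0 (Metric.mem_ball_self hρpos)
    rw [hM0] at this
    exact (mem_subdiff_iff hf hc).2 this
  · rw [regularityInequality_iff (by positivity) (by positivity)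
      fun u hu => multiInv_subdiff_eq_singleton hf hc Metric.isOpen_ball (hsing u hu)]
    intro x hx u hu v hv
    obtain ⟨hxd, hxle⟩ := (mem_subdiff_iff hf hc).1 hv
    have h1 := hgrow u (hρδ u hu) x (Metric.ball_subset_closedBall (hρr hx)) hxd
    have h2 := hxle (M u) (hsub u hu).1
    have h3 := hφ.rightDeriv_mul_le hφc hφd (by positivity : 0 ≤ κ / 2 * ‖x - M u‖)
    rw [show 2 * (κ / 2 * ‖x - M u‖) = κ * ‖x - M u‖ by ring] at h3
    have h4 : (u - v) (M u - x) ≤ ‖u - v‖ * ‖x - M u‖ := by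
      rw [norm_sub_rev x]
      exact (le_abs_self _).trans ((u - v).le_opNorm _)
    simp only [sub_apply, map_sub] at h2 h4
    have h5 : rightDeriv φ (κ / 2 * ‖x - M u‖) * (κ / 2 * ‖x - M u‖) ≤
        τ * (‖u - v‖ * ‖x - M u‖) :=
      (h3.trans h1).trans (mul_le_mul_of_nonneg_left (by linarith) hτ.le)
    rcases (norm_nonneg (x - M u)).eq_or_lt with h0 | h0
    -- Here `x = M u`, so nothing can be cancelled; `φ'(0) = 0` settles the case.
    · simpa [← h0, hφ0] using mul_nonneg (by positivity : 0 ≤ 2 * τ / κ) (norm_nonneg (u - v))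
    · rw [div_mul_eq_mul_div (2 * τ), le_div_iff₀ hκ]
      refine le_of_mul_le_mul_right ?_ h0
      linarith

theorem IsStronglyMetricallyRegular.hasSLWP (hφ : IsAdmissible φ)
    (hφc : StrictConvexOn ℝ (Ici 0) φ) (hφd : DifferentiableOn ℝ φ (Ici 0))
    (hφ0 : rightDeriv φ 0 = 0) (hf : IsProper f) (hc : IsConvexFun f)
    (h : IsStronglyMetricallyRegular (rightDeriv φ) (subdiff f) xbar 0) :
    HasSLWP φ f xbar := by
  obtain ⟨h0, r, τ, κ, δ, hr, hτ, hκ, hδ, hreg, hsing⟩ := h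
  have hmono := strictMonoOn_rightDeriv hφc hφd
  choose! M hM using hsing
  have hinv : ∀ u ∈ Metric.ball (0 : StrongDual ℝ X) r, multiInv (subdiff f) u = {M u} :=
    fun u hu => multiInv_subdiff_eq_singleton hf hc Metric.isOpen_ball (hM u hu)
  have hsub : ∀ u ∈ Metric.ball (0 : StrongDual ℝ X) r, IsSubgradient f (M u) u := fun u hu =>
    (mem_subdiff_iff hf hc).1 (show M u ∈ multiInv (subdiff f) u from hinv u hu ▸ rfl)
  rw [regularityInequality_iff hτ.le hκ hinv] at hreg
  have hM0 : M 0 = xbar := by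
    have : xbar ∈ multiInv (subdiff f) 0 := h0
    rw [hinv 0 (Metric.mem_ball_self hr)] at this
    exact this.symm
  have hpos : 0 < rightDeriv φ (τ * r) := by
    rw [← hφ0]
    exact hmono (mem_Ici.2 le_rfl) (mem_Ici.2 (by positivity)) (by positivity)
  /- Small functionals have their minimizers close to `xbar`. -/
  have hnear : ∀ ε : ℝ, 0 < ε → ∀ u ∈ Metric.ball (0 : StrongDual ℝ X) r,
      κ * ‖u‖ < rightDeriv φ (τ * ε) → M u ∈ Metric.ball xbar ε := by
    intro ε hε u hu hlt
    have h1 := (hreg xbar (Metric.mem_ball_self hr) u hu 0 h0).trans_lt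
      (by rwa [sub_zero])
    rw [hmono.lt_iff_lt (mem_Ici.2 (by positivity)) (mem_Ici.2 (by positivity))] at h1
    rw [mem_ball_iff_norm, norm_sub_rev]
    exact lt_of_mul_lt_mul_left h1 hτ.le
  -- Halved because both `u` and the perturbation `v - u` will have norm below `η`, while `M v` must
  -- still fall in the ball where regularity holds.
  set η := min r (rightDeriv φ (τ * r) / κ) / 2 with hη
  have hηpos : 0 < η := by positivity
  have hηball : ∀ v : StrongDual ℝ X, ‖v‖ < 2 * η →
      v ∈ Metric.ball (0 : StrongDual ℝ X) r ∧ M v ∈ Metric.ball xbar r := by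
    intro v hv
    rw [hη, mul_div_cancel₀ _ two_ne_zero, lt_min_iff, lt_div_iff₀ hκ] at hv
    have hvr := mem_ball_zero_iff.2 hv.1
    exact ⟨hvr, hnear r hr v hvr (by linarith [hv.2])⟩
  obtain ⟨T, hT, hTη⟩ := hφ.exists_rightDeriv_lt hφc.convexOn hφd hφ0 (mul_pos hκ hηpos)
  -- Points of the closed `R`-ball satisfy `q ≤ 2R`, hence `(τ/2) q ≤ T` and the perturbation size
  -- `s` stays below `η`.
  set R := T / τ with hR
  have hRpos : 0 < R := by positivity
  -- The second term forces `M u` into the `R`-ball.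
  set D := min η (rightDeriv φ (τ * R) / κ) with hD
  have hDpos : 0 < D := by
    refine lt_min hηpos (div_pos ?_ hκ)
    rw [← hφ0]
    exact hmono (mem_Ici.2 le_rfl) (mem_Ici.2 (by positivity)) (by positivity)
  refine ⟨h0.1, D, R, κ * τ, τ / 2, hDpos, hRpos, by positivity, by positivity, M, hM0, ?_⟩
  intro u hu
  rw [mem_ball_zero_iff, hD, lt_min_iff, lt_div_iff₀ hκ] at hu
  have hur := (hηball u (by linarith)).1
  have huR := Metric.ball_subset_closedBall (hnear R hRpos u hur (by linarith [hu.2]))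
  refine ⟨huR, fun x hx => ?_⟩
  rw [coe_le_mul_tilt_sub_iff hf (hsub u hur).1 (by positivity)]
  intro hxd
  set q := ‖x - M u‖ with hq
  have hq0 : 0 ≤ q := norm_nonneg _
  have hqR : q ≤ 2 * R := by
    have := dist_triangle_right x (M u) xbar
    rw [dist_eq_norm x (M u)] at this
    linarith [Metric.mem_closedBall.1 hx, Metric.mem_closedBall.1 huR]
  -- The largest perturbation for which regularity yields `φ'(τ‖M v - M u‖) ≤ φ'(τ q / 2)`.
  set s := rightDeriv φ (τ / 2 * q) / κ with hs
  have hs0 : 0 ≤ s := by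
    refine div_nonneg ?_ hκ.le
    rw [← hφ0]
    exact hmono.monotoneOn (mem_Ici.2 le_rfl) (mem_Ici.2 (by positivity)) (by positivity)
  have hsη : s < η := by
    rw [hs, div_lt_iff₀ hκ, mul_comm η]
    refine (hmono.monotoneOn (mem_Ici.2 (by positivity)) (mem_Ici.2 hT.le) ?_).trans_lt hTη
    have : τ * R = T := mul_div_cancel₀ _ hτ.ne'
    nlinarith
  -- Asking only `‖g‖ ≤ 1` also covers `x = M u`.
  obtain ⟨g, hg1, hgx⟩ := exists_dual_vector'' ℝ (x - M u)
  have hgx : g (x - M u) = q := hgx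
  set v := u + s • g with hv
  have hvu : ‖v - u‖ ≤ s := by
    rw [hv, add_sub_cancel_left, norm_smul, Real.norm_of_nonneg hs0]
    exact mul_le_of_le_one_right hs0 hg1
  obtain ⟨hvr, hMv⟩ := hηball v (by linarith [norm_le_norm_add_norm_sub' v u])
  have hdist : ‖M v - M u‖ ≤ q / 2 := by
    have h1 := hreg (M v) hMv u hur v ((mem_subdiff_iff hf hc).2 (hsub v hvr))
    rw [norm_sub_rev u] at h1
    have h2 : rightDeriv φ (τ * ‖M v - M u‖) ≤ rightDeriv φ (τ / 2 * q) := by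
      refine h1.trans ((mul_le_mul_of_nonneg_left hvu hκ.le).trans_eq ?_)
      rw [hs, mul_div_cancel₀ _ hκ.ne']
    rw [hmono.le_iff_le (mem_Ici.2 (by positivity)) (mem_Ici.2 (by positivity))] at h2
    refine le_of_mul_le_mul_left ?_ hτ
    linarith
  have hgdist : g (M v - M u) ≤ q / 2 :=
    ((le_abs_self _).trans (g.le_opNorm _)).trans
      ((mul_le_of_le_one_left (norm_nonneg _) hg1).trans hdist)
  have h1 := (hsub v hvr).2 x hxd
  have h2 := (hsub u hur).2 (M v) (hsub v hvr).1
  have h3 := hφ.le_rightDeriv_mul hφc.convexOn hφd (by positivity : 0 ≤ τ / 2 * q)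
  have h4 : rightDeriv φ (τ / 2 * q) = κ * s := by rw [hs, mul_div_cancel₀ _ hκ.ne']
  simp only [hv, add_apply, smul_apply, smul_eq_mul,
    map_sub] at h1 h2 hgx hgdist
  -- Sum of the subgradient inequalities for `v` from `M v` to `x` and for `u` from `M u` to `M v`;
  -- the surplus is `s g(x - M v)`.
  have h5 : s * (q / 2) ≤ ((f x).toReal - u x) - ((f (M u)).toReal - u (M u)) := by
    have := mul_le_mul_of_nonneg_left (show q / 2 ≤ g x - g (M v) by linarith) hs0
    linarith
  rw [h4] at h3
  refine h3.trans ?_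
  calc κ * s * (τ / 2 * q) = κ * τ * (s * (q / 2)) := by ring
    _ ≤ _ := mul_le_mul_of_nonneg_left h5 (by positivity)

end Equivalence

end StableWellPosedness

theorem corollary3p5 {X : Type*} [NormedAddCommGroup X] [NormedSpace ℝ X] [CompleteSpace X]
    (φ : ℝ → ℝ) (hφ : StableWellPosedness.IsAdmissible φ)
    (hφ_conv : StrictConvexOn ℝ (Set.Ici 0) φ)
    (hφ_diff : DifferentiableOn ℝ φ (Set.Ici 0))
    (hφ_zero : StableWellPosedness.rightDeriv φ 0 = 0)
    (f : X → EReal) (hf_proper : StableWellPosedness.IsProper f)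
    (hf_lsc : LowerSemicontinuous f) (hf_conv : StableWellPosedness.IsConvexFun f)
    (xbar : X) (hxbar : xbar ∈ StableWellPosedness.effDom f) :
    StableWellPosedness.HasSLWP φ f xbar ↔
      StableWellPosedness.IsStronglyMetricallyRegular
        (StableWellPosedness.rightDeriv φ) (StableWellPosedness.subdiff f) xbar 0 :=
  ⟨fun h => h.isStronglyMetricallyRegular hφ hφ_conv.convexOn hφ_diff hφ_zero hf_proper hf_conv,
    fun h => h.hasSLWP hφ hφ_conv hφ_diff hφ_zero hf_proper hf_conv⟩
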